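/- Let $X$ be a real or complex Banach space. For a bounded convex set $C\subseteq X$, a \emph{slice} of $C$ is a set $S(C,x^*,\varepsilon)=\{x\in C:\operatorname{Re}x^*(x)>\sup\operatorname{Re}x^*(C)-\varepsilon\}$ with $x^*\in X^*$ and $\varepsilon>0$, and a \emph{convex combination of slices} of $C$ is a Minkowski sum $\sum_{i=1}^m\lambda_iS_i$ with slices $S_i$ of $C$, $\lambda_i>0$ and $\sum_i\lambda_i=1$. A bounded convex set $A$ is \emph{slicely countably determined} (SCD) if there is a sequence $(S_n)_{n\in\mathbb N}$ of slices of $A$ such that $A\subseteq\overline{\mathrm{conv}}(B)$ for every $B\subseteq A$ that intersects all the $S_n$. Theorem. Let $A\subseteq X$ be closed, convex, bounded and separable. Suppose that at least one of the following holds. (1) $A$ has \emph{small combinations of slices}: every slice of $A$ contains convex combinations of slices of $A$ of arbitrarily small diameter. (2) $A$ is \emph{strongly regular}: every non-empty convex $L\subseteq A$ contains convex combinations of slices of $L$ of arbitrarily small diameter. (3) $A$ has the \emph{convex point of continuity property} (CPCP): every non-empty closed convex $B\subseteq A$ contains a point of continuity of the identity map from $B$ with the weak topology to $B$ with the norm topology.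 (4) $A$ is a \emph{Radon--Nikod\'ym (RNP) set}: for every probability space $(\Omega,\Sigma,P)$ and every countably additive $m:\Sigma\to X$ that vanishes on $P$-null sets and satisfies $m(E)/P(E)\in A$ whenever $E\in\Sigma$ and $P(E)>0$, there is a Bochner integrable $f:\Omega\to X$ with $m(E)=\int_E f\,dP$ for all $E\in\Sigma$. Then $A$ is an SCD set. -/

import Mathlib

namespace SCD

open MeasureTheory

section Slices

variable (𝕜 : Type*) [RCLike 𝕜] {X : Type*} [NormedAddCommGroup X] [NormedSpace 𝕜 X]

/-- The slice `S(A, x*, ε) = {x ∈ A : Re x*(x) > sup Re x*(A) - ε}`. -/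
def slice (A : Set X) (f : X →L[𝕜] 𝕜) (ε : ℝ) : Set X :=
  {x | x ∈ A ∧ sSup ((fun y => RCLike.re (f y)) '' A) - ε < RCLike.re (f x)}

/-- `S` is a slice of `A`. -/
def IsSlice (A S : Set X) : Prop :=
  ∃ (f : X →L[𝕜] 𝕜) (ε : ℝ), 0 < ε ∧ S = slice 𝕜 A f ε

variable [NormedSpace ℝ X]

/-- `C` is a convex combination `∑ λ i • S i` (Minkowski sum, `λ i > 0`, `∑ λ i = 1`)
of slices of `A`. -/
def IsConvexCombinationOfSlices (A C : Set X) : Prop :=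
  ∃ (m : ℕ) (w : Fin m → ℝ) (S : Fin m → Set X),
    (∀ i, 0 < w i) ∧ ∑ i, w i = 1 ∧ (∀ i, IsSlice 𝕜 A (S i)) ∧
      C = {x | ∃ s : Fin m → X, (∀ i, s i ∈ S i) ∧ x = ∑ i, w i • s i}

/-- A sequence of subsets of `A` is determining for `A` if the closed convex hull of every
`B ⊆ A` meeting all of them contains `A`. -/
def IsDetermining (A : Set X) (V : ℕ → Set X) : Prop :=
  (∀ n, V n ⊆ A) ∧
    ∀ B : Set X, B ⊆ A → (∀ n, (B ∩ V n).Nonempty) → A ⊆ closure (convexHull ℝ B)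

/-- Slicely countably determined sets. -/
def IsSCDSet (A : Set X) : Prop :=
  Convex ℝ A ∧ Bornology.IsBounded A ∧
    ∃ V : ℕ → Set X, (∀ n, IsSlice 𝕜 A (V n)) ∧ IsDetermining A V

/-- Every slice of the bounded set `A` contains convex combinations of slices of `A` of
arbitrarily small diameter. -/
def HasSmallCombinationsOfSlices (A : Set X) : Prop :=
  ∀ S : Set X, IsSlice 𝕜 A S → ∀ δ : ℝ, 0 < δ →
    ∃ C : Set X, IsConvexCombinationOfSlices 𝕜 A C ∧ C ⊆ S ∧ Metric.diam C < δ

/-- Every non-empty convex subset `L` of the bounded set `A` contains convex combinations of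
slices of `L` of arbitrarily small diameter. -/
def IsStronglyRegular (A : Set X) : Prop :=
  ∀ L : Set X, L ⊆ A → L.Nonempty → Convex ℝ L → ∀ δ : ℝ, 0 < δ →
    ∃ C : Set X, IsConvexCombinationOfSlices 𝕜 L C ∧ C ⊆ L ∧ Metric.diam C < δ

/-- `x` is a point of continuity of the identity `(B, weak) → (B, norm)`. -/
def IsWeakNormContinuityPoint {X : Type*} [NormedAddCommGroup X] [NormedSpace 𝕜 X]
    (B : Set X) (x : X) : Prop :=
  x ∈ B ∧ ContinuousWithinAt (fun y : WeakSpace 𝕜 X => (toWeakSpace 𝕜 X).symm y)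
    (toWeakSpace 𝕜 X '' B) (toWeakSpace 𝕜 X x)

/-- The convex point of continuity property. -/
def HasCPCP (A : Set X) : Prop :=
  ∀ B : Set X, B ⊆ A → B.Nonempty → Convex ℝ B → IsClosed B →
    ∃ x, IsWeakNormContinuityPoint 𝕜 B x

end Slices

/-- Radon-Nikodým sets: every countably additive `X`-valued measure `m` on a probability space
`(Ω, P)` that is absolutely continuous with respect to `P` and whose average range
`{m E / P E : P E > 0}` lies in `A` has a Bochner integrable density with respect to `P`. -/
def IsRadonNikodymSet {X : Type*} [NormedAddCommGroup X] [NormedSpace ℝ X] (A : Set X) : Prop :=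
  ∀ (Ω : Type) [MeasurableSpace Ω] (P : Measure Ω) [IsProbabilityMeasure P]
    (m : VectorMeasure Ω X),
    (∀ E, MeasurableSet E → P E = 0 → m E = 0) →
    (∀ E, MeasurableSet E → P E ≠ 0 → (P.real E)⁻¹ • m E ∈ A) →
      ∃ f : Ω → X, Integrable f P ∧ ∀ E, MeasurableSet E → m E = ∫ ω in E, f ω ∂P

end SCD

namespace SCD

open MeasureTheory

/-! ### Slices, their convex combinations, and the countability criterion for SCD -/

section SliceBasics

variable {𝕜 : Type*} [RCLike 𝕜] {X : Type*} [NormedAddCommGroup X] [NormedSpace 𝕜 X]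

/-! If a slice contains `∑ λ i • S i`, then every `B` meeting all the `S i` has a convex combination
in that slice. Since Hahn–Banach separates a point of `A` from a closed convex hull by a slice, `A`
is SCD once countably many convex combinations of slices suffice to have one inside each slice
(`isSCDSet_of_countable_combinations`). Under (1), separability provides them: choose one
combination in each small ball around a point of a countable dense set, whenever there is one.

The other conditions reduce to (1). For (2) and (3) the bridge is Bourgain's lemma, which turns
relatively weakly open sets into convex combinations of slices of `A`; it is proved by a
nearly-farthest-point argument in a finite-dimensional Hilbert image of `A`.

For (4), a convex `L ⊆ A` without small slices carries a separated bush: each point is nearly an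
average of points of `L` far from it. Spread over `[0, 1)`, its levels form an approximate
martingale that defines a vector measure with averages in `A`. A density of that measure would be
the L¹ limit of the levels, yet consecutive levels stay `δ` apart (`IsRadonNikodymSet.not_isBush`).
-/

theorem bddAbove_re_image {A : Set X} (hA : Bornology.IsBounded A) (f : X →L[𝕜] 𝕜) :
    BddAbove ((fun y => RCLike.re (f y)) '' A) := by
  obtain ⟨M, hM⟩ := hA.exists_norm_le
  refine ⟨‖f‖ * M, ?_⟩
  rintro _ ⟨y, hy, rfl⟩
  calc RCLike.re (f y) ≤ ‖f y‖ := RCLike.re_le_norm _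
    _ ≤ ‖f‖ * ‖y‖ := f.le_opNorm y
    _ ≤ ‖f‖ * M := by gcongr; exact hM y hy

theorem IsSlice.subset {A S : Set X} (hS : IsSlice 𝕜 A S) : S ⊆ A := by
  obtain ⟨f, ε, -, rfl⟩ := hS
  exact fun x hx => hx.1

theorem IsSlice.nonempty {A S : Set X} (hne : A.Nonempty) (hS : IsSlice 𝕜 A S) :
    S.Nonempty := by
  obtain ⟨f, ε, hε, rfl⟩ := hS
  obtain ⟨_, ⟨x, hx, rfl⟩, hlt⟩ :=
    exists_lt_of_lt_csSup (hne.image (fun y => RCLike.re (f y)))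
      (sub_lt_self (sSup ((fun y => RCLike.re (f y)) '' A)) hε)
  exact ⟨x, hx, hlt⟩

/-- A non-empty intersection of a bounded set with an open half-space is a slice. -/
theorem isSlice_of_mem_of_lt {A : Set X} (hA : Bornology.IsBounded A) (f : X →L[𝕜] 𝕜) {a : ℝ}
    {x : X} (hx : x ∈ A) (ha : a < RCLike.re (f x)) :
    IsSlice 𝕜 A {y | y ∈ A ∧ a < RCLike.re (f y)} := by
  refine ⟨f, sSup ((fun y => RCLike.re (f y)) '' A) - a, ?_, ?_⟩
  · have : RCLike.re (f x) ≤ sSup ((fun y => RCLike.re (f y)) '' A) :=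
      le_csSup (bddAbove_re_image hA f) ⟨x, hx, rfl⟩
    linarith
  · simp [slice]

variable [NormedSpace ℝ X]

theorem IsConvexCombinationOfSlices.subset {A C : Set X} (hA : Convex ℝ A)
    (hC : IsConvexCombinationOfSlices 𝕜 A C) : C ⊆ A := by
  obtain ⟨m, w, S, hw, hw1, hS, rfl⟩ := hC
  rintro _ ⟨s, hs, rfl⟩
  exact hA.sum_mem (fun i _ => (hw i).le) hw1 fun i _ => (hS i).subset (hs i)

theorem IsConvexCombinationOfSlices.nonempty {A C : Set X} (hne : A.Nonempty)
    (hC : IsConvexCombinationOfSlices 𝕜 A C) : C.Nonempty := by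
  obtain ⟨m, w, S, hw, hw1, hS, rfl⟩ := hC
  choose s hs using fun i => (hS i).nonempty hne
  exact ⟨_, s, hs, rfl⟩

theorem isConvexCombinationOfSlices_of_fintype {A : Set X} {ι : Type*} [Fintype ι]
    {w : ι → ℝ} {S : ι → Set X} (hw : ∀ i, 0 < w i) (hw1 : ∑ i, w i = 1)
    (hS : ∀ i, IsSlice 𝕜 A (S i)) :
    IsConvexCombinationOfSlices 𝕜 A {x | ∃ s : ι → X, (∀ i, s i ∈ S i) ∧ x = ∑ i, w i • s i} := by
  let e := (Fintype.equivFin ι).symm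
  refine ⟨Fintype.card ι, w ∘ e, S ∘ e, fun i => hw _, ?_, fun i => hS _, ?_⟩
  · rw [← hw1]; exact e.sum_comp w
  · ext x
    constructor
    · rintro ⟨s, hs, rfl⟩
      exact ⟨s ∘ e, fun i => hs _, (e.sum_comp fun i => w i • s i).symm⟩
    · rintro ⟨s, hs, rfl⟩
      refine ⟨s ∘ e.symm, fun i => by simpa using hs (e.symm i), ?_⟩
      rw [← e.sum_comp]
      simp

theorem IsSlice.isConvexCombinationOfSlices {A S : Set X} (hS : IsSlice 𝕜 A S) :
    IsConvexCombinationOfSlices 𝕜 A S := by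
  have := isConvexCombinationOfSlices_of_fintype (𝕜 := 𝕜) (A := A) (ι := Unit) (w := fun _ => 1)
    (S := fun _ => S) (fun _ => one_pos) (by simp) (fun _ => hS)
  convert this using 1
  ext x
  constructor
  · exact fun hx => ⟨fun _ => x, fun _ => hx, by simp⟩
  · rintro ⟨s, hs, rfl⟩
    simpa using hs ()

/-- If each summand of a Minkowski convex combination contains a convex combination of slices,
then so does the combination. -/
theorem exists_isConvexCombinationOfSlices_subset_sum {A : Set X} {ι : Type*} [Fintype ι]
    {w : ι → ℝ} {W : ι → Set X} (hw : ∀ i, 0 < w i) (hw1 : ∑ i, w i = 1)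
    (hW : ∀ i, ∃ C, IsConvexCombinationOfSlices 𝕜 A C ∧ C ⊆ W i) :
    ∃ C, IsConvexCombinationOfSlices 𝕜 A C ∧
      C ⊆ {x | ∃ s : ι → X, (∀ i, s i ∈ W i) ∧ x = ∑ i, w i • s i} := by
  choose C hC hCW using hW
  choose m v S hv hv1 hS hCe using hC
  refine ⟨_, isConvexCombinationOfSlices_of_fintype (ι := Σ i, Fin (m i))
    (w := fun p => w p.1 * v p.1 p.2) (S := fun p => S p.1 p.2)
    (fun p => mul_pos (hw _) (hv _ _)) ?_ (fun p => hS _ _), ?_⟩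
  · rw [Fintype.sum_sigma]
    simp [← Finset.mul_sum, hv1, hw1]
  · rintro _ ⟨s, hs, rfl⟩
    refine ⟨fun i => ∑ j, v i j • s ⟨i, j⟩, fun i => hCW i ?_, ?_⟩
    · rw [hCe]
      exact ⟨fun j => s ⟨i, j⟩, fun j => hs ⟨i, j⟩, rfl⟩
    · rw [Fintype.sum_sigma]
      simp [Finset.smul_sum, mul_smul]

theorem isSCDSet_empty : IsSCDSet 𝕜 (∅ : Set X) :=
  ⟨convex_empty, Bornology.isBounded_empty, fun _ => slice 𝕜 ∅ 0 1,
    fun _ => ⟨0, 1, one_pos, rfl⟩, fun _ _ hx => hx.1, fun _ _ _ => Set.empty_subset _⟩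

variable [IsScalarTower ℝ 𝕜 X]

theorem exists_clm_re_eq (𝕜 : Type*) [RCLike 𝕜] [NormedSpace 𝕜 X] [IsScalarTower ℝ 𝕜 X]
    (g : X →L[ℝ] ℝ) : ∃ f : X →L[𝕜] 𝕜, ∀ x, RCLike.re (f x) = g x :=
  ⟨StrongDual.extendRCLike g, fun x => by
    simp [StrongDual.extendRCLike_apply]⟩

theorem isLinearMap_re_clm (f : X →L[𝕜] 𝕜) : IsLinearMap ℝ fun y => RCLike.re (f y) where
  map_add := by simp
  map_smul c y := by
    rw [← algebraMap_smul 𝕜 c y, map_smul, smul_eq_mul, RCLike.algebraMap_eq_ofReal,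
      RCLike.re_ofReal_mul, smul_eq_mul]

theorem exists_slice_disjoint_convexHull {A B : Set X} (hA : Bornology.IsBounded A) {x : X}
    (hx : x ∈ A) (hxB : x ∉ closure (convexHull ℝ B)) :
    ∃ S, IsSlice 𝕜 A S ∧ Disjoint S (convexHull ℝ B) := by
  obtain ⟨f, u, hu, hux⟩ := RCLike.geometric_hahn_banach_closed_point (𝕜 := 𝕜)
    (convex_convexHull ℝ B).closure isClosed_closure hxB
  refine ⟨_, isSlice_of_mem_of_lt hA f hx hux, Set.disjoint_left.2 fun y hy hyB => ?_⟩
  exact lt_asymm hy.2 (hu y (subset_closure hyB))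

/-- A bounded convex set is slicely countably determined as soon as countably many convex
combinations of its slices suffice to have one inside each slice. -/
theorem isSCDSet_of_countable_combinations {A : Set X} (hconv : Convex ℝ A)
    (hA : Bornology.IsBounded A) {ι : Type*} [Countable ι] (C : ι → Set X)
    (hC : ∀ i, IsConvexCombinationOfSlices 𝕜 A (C i))
    (hCS : ∀ S, IsSlice 𝕜 A S → ∃ i, C i ⊆ S) : IsSCDSet 𝕜 A := by
  refine ⟨hconv, hA, ?_⟩
  choose m w S hw hw1 hS hCe using hC
  -- Any one slice yields some `C i₀`; its weights sum to 1, so it has a summand. Enumerating the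
  -- slices by `ℕ` requires this.
  have hslice : IsSlice 𝕜 A (slice 𝕜 A 0 1) := ⟨0, 1, one_pos, rfl⟩
  obtain ⟨i₀, -⟩ := hCS _ hslice
  have : Nonempty (Σ i, Fin (m i)) := by
    refine ⟨i₀, ⟨0, Nat.pos_of_ne_zero fun h => ?_⟩⟩
    have := hw1 i₀
    have : IsEmpty (Fin (m i₀)) := by rw [h]; infer_instance
    simp_all
  obtain ⟨e, he⟩ := exists_surjective_nat (Σ i, Fin (m i))
  refine ⟨fun n => S (e n).1 (e n).2, fun n => hS _ _, fun n => (hS _ _).subset,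
    fun B hB hBV x hx => ?_⟩
  by_contra hxB
  obtain ⟨T, hT, hTB⟩ := exists_slice_disjoint_convexHull (𝕜 := 𝕜) hA hx hxB
  obtain ⟨i, hi⟩ := hCS T hT
  have hmeet : ∀ j, (B ∩ S i j).Nonempty := fun j => by
    obtain ⟨n, hn⟩ := he ⟨i, j⟩
    have := hBV n
    simp only at this
    rwa [hn] at this
  choose s hsB hsS using hmeet
  refine Set.disjoint_left.1 hTB (hi ?_) ((convex_convexHull ℝ B).sum_mem
    (fun j _ => (hw i j).le) (hw1 i) fun j _ => subset_convexHull ℝ B (hsB j))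
  rw [hCe]
  exact ⟨s, hsS, rfl⟩

theorem HasSmallCombinationsOfSlices.isSCDSet {A : Set X} (hconv : Convex ℝ A)
    (hA : Bornology.IsBounded A) (hsep : TopologicalSpace.IsSeparable A)
    (h : HasSmallCombinationsOfSlices 𝕜 A) : IsSCDSet 𝕜 A := by
  rcases A.eq_empty_or_nonempty with rfl | hne
  · exact isSCDSet_empty
  obtain ⟨c, hc, hAc⟩ := hsep
  -- Pairs (centre, radius) whose ball contains some combination; one is then fixed per pair.
  let ι := {p : c × ℕ // ∃ C, IsConvexCombinationOfSlices 𝕜 A C ∧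
    C ⊆ Metric.ball (p.1 : X) (1 / ((p.2 : ℝ) + 1))}
  have : Countable c := hc
  choose C hC hCball using fun p : ι => p.2
  refine isSCDSet_of_countable_combinations hconv hA C hC ?_
  rintro _ ⟨f, ε, hε, rfl⟩
  obtain ⟨n, hn⟩ := exists_nat_one_div_lt (K := ℝ) (ε := ε / (4 * (‖f‖ + 1))) (by positivity)
  have hn' : ‖f‖ * (2 * (1 / ((n : ℝ) + 1))) ≤ ε / 2 := by
    rw [lt_div_iff₀ (by positivity)] at hn
    have : 0 ≤ 1 / ((n : ℝ) + 1) := by positivity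
    nlinarith [norm_nonneg f]
  -- `D` lies in the thinner slice. The chosen combination shares a ball with `D`, so `Re f` drops
  -- by at most the remaining `ε / 2`.
  obtain ⟨D, hD, hDS, hdiam⟩ := h _ ⟨f, ε / 2, half_pos hε, rfl⟩ (1 / ((n : ℝ) + 1) / 2)
    (by positivity)
  obtain ⟨d, hd⟩ := hD.nonempty hne
  obtain ⟨a, hac, had⟩ := Metric.mem_closure_iff.1 (hAc (hD.subset hconv hd))
    (1 / ((n : ℝ) + 1) / 2) (by positivity)
  have hDball : D ⊆ Metric.ball a (1 / ((n : ℝ) + 1)) := fun y hy => by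
    have := Metric.dist_le_diam_of_mem (hA.subset (hD.subset hconv)) hy hd
    rw [Metric.mem_ball]
    linarith [dist_triangle y d a]
  refine ⟨⟨(⟨a, hac⟩, n), D, hD, hDball⟩, fun y hy => ⟨(hC _).subset hconv hy, ?_⟩⟩
  have h1 := hCball _ hy
  have h2 := (hDS hd).2
  rw [Metric.mem_ball] at h1
  have h3 : ‖d - y‖ ≤ 2 * (1 / ((n : ℝ) + 1)) := by
    rw [← dist_eq_norm]
    have := hDball hd
    rw [Metric.mem_ball] at this
    have h4 := dist_triangle_right d y a
    simp only at h1
    linarith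
  have h4 : RCLike.re (f d) - RCLike.re (f y) ≤ ε / 2 := by
    rw [← map_sub, ← map_sub]
    calc _ ≤ ‖f (d - y)‖ := RCLike.re_le_norm _
      _ ≤ ‖f‖ * ‖d - y‖ := f.le_opNorm _
      _ ≤ ‖f‖ * (2 * (1 / ((n : ℝ) + 1))) := by gcongr
      _ ≤ ε / 2 := hn'
  linarith

end SliceBasics

/-! ### Bourgain's lemma; strong regularity and CPCP -/

section WeaklyOpen

open scoped InnerProductSpace in
/-- A bounded subset of a Hilbert space lies in the closed convex hull of its points that have
small slices around them. -/
theorem mem_closure_convexHull_small_slices {E : Type*} [NormedAddCommGroup E]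
    [InnerProductSpace ℝ E] [CompleteSpace E] {K : Set E} (hK : Bornology.IsBounded K) {x : E}
    (hx : x ∈ K) {δ : ℝ} (hδ : 0 < δ) :
    x ∈ closure (convexHull ℝ {z | z ∈ K ∧ ∃ (v : E) (a : ℝ), a < ⟪v, z⟫_ℝ ∧
      ∀ y ∈ K, a < ⟪v, y⟫_ℝ → ‖y - z‖ < δ}) := by
  by_contra hcon
  obtain ⟨f, u, hu, hux⟩ := geometric_hahn_banach_closed_point
    (convex_convexHull ℝ _).closure isClosed_closure hcon
  obtain ⟨g, rfl⟩ := (InnerProductSpace.toDual ℝ E).surjective f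
  simp only [InnerProductSpace.toDual_apply_apply] at hu hux
  obtain ⟨M, hM⟩ := hK.exists_norm_le
  have hM0 : 0 ≤ M := (norm_nonneg x).trans (hM x hx)
  -- Points of the slice found below satisfy `‖y - z‖ ^ 2 < θ + 2 * θ = δ ^ 2`.
  obtain ⟨θ, hθ⟩ : ∃ θ, θ = δ ^ 2 / 3 := ⟨_, rfl⟩
  have hθ0 : 0 < θ := by rw [hθ]; positivity
  -- The centre `c = x - t • g` is so remote that a point of `K` with `⟪g, z⟫ < u` is too close to
  -- `c` to be nearly farthest. But a nearly farthest `z` has a small slice around it, cut by `z -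
  -- c`, hence satisfies that inequality.
  obtain ⟨t, ht⟩ : ∃ t, t = ((2 * M) ^ 2 + θ) / (⟪g, x⟫_ℝ - u) := ⟨_, rfl⟩
  have hκ : 0 < ⟪g, x⟫_ℝ - u := sub_pos.2 hux
  have ht0 : 0 < t := by rw [ht]; positivity
  have htκ : t * (⟪g, x⟫_ℝ - u) = (2 * M) ^ 2 + θ := by rw [ht]; field_simp
  obtain ⟨c, hc⟩ : ∃ c, c = x - t • g := ⟨_, rfl⟩
  have hbdd : BddAbove ((fun y => ‖y - c‖ ^ 2) '' K) := by
    refine ⟨(M + ‖c‖) ^ 2, ?_⟩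
    rintro _ ⟨y, hy, rfl⟩
    have := norm_sub_le y c
    have := hM y hy
    simp only
    gcongr
    linarith
  obtain ⟨_, ⟨z, hz, rfl⟩, hlt⟩ := exists_lt_of_lt_csSup (Set.Nonempty.image _ ⟨x, hx⟩)
    (sub_lt_self (sSup ((fun y => ‖y - c‖ ^ 2) '' K)) hθ0)
  have hfar : ∀ y ∈ K, ‖y - c‖ ^ 2 - θ < ‖z - c‖ ^ 2 := fun y hy => by
    have := le_csSup hbdd ⟨y, hy, rfl⟩
    simp only at this hlt
    linarith
  have hzmem : ⟪g, z⟫_ℝ < u := by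
    refine hu z (subset_closure (subset_convexHull ℝ _ ⟨hz, z - c, ⟪z - c, z⟫_ℝ - θ, by linarith,
      fun y hy hyz => ?_⟩))
    have h1 := hfar y hy
    have h2 : ‖y - c‖ ^ 2 = ‖y - z‖ ^ 2 + 2 * ⟪z - c, y - z⟫_ℝ + ‖z - c‖ ^ 2 := by
      rw [← sub_add_sub_cancel y z c, norm_add_sq_real, real_inner_comm]
    rw [inner_sub_right] at h2
    have h3 : ‖y - z‖ ^ 2 < δ ^ 2 := by linarith
    exact lt_of_pow_lt_pow_left₀ 2 hδ.le h3
  have h1 := hfar x hx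
  have h2 : ‖z - c‖ ^ 2 = ‖z - x‖ ^ 2 + 2 * (t * ⟪g, z - x⟫_ℝ) + ‖x - c‖ ^ 2 := by
    rw [← sub_add_sub_cancel z x c, norm_add_sq_real, real_inner_comm]
    simp [hc, inner_smul_left]
  have h3 : ‖z - x‖ ^ 2 ≤ (2 * M) ^ 2 := by
    have := norm_sub_le z x
    have := hM z hz
    have := hM x hx
    gcongr
    linarith
  rw [inner_sub_right] at h2
  nlinarith [mul_lt_mul_of_pos_left hzmem ht0]

variable {𝕜 : Type*} [RCLike 𝕜] {X : Type*} [NormedAddCommGroup X] [NormedSpace 𝕜 X]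
  [NormedSpace ℝ X] [IsScalarTower ℝ 𝕜 X]

/-- Approximate `T x` by a convex combination of points of `T '' A` having small slices around them.
Those slices pull back under `T` to slices of `A`, and the same weights work. -/
theorem exists_isConvexCombinationOfSlices_map_mem_ball {A : Set X}
    (hA : Bornology.IsBounded A) {E : Type*} [NormedAddCommGroup E] [InnerProductSpace ℝ E]
    [CompleteSpace E] (T : X →L[ℝ] E) {x : X} (hx : x ∈ A) {δ : ℝ} (hδ : 0 < δ) :
    ∃ C, IsConvexCombinationOfSlices 𝕜 A C ∧ ∀ y ∈ C, ‖T y - T x‖ < δ := by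
  have hK : Bornology.IsBounded (T '' A) := T.lipschitz.isBounded_image hA
  obtain ⟨p, hp, hpx⟩ := Metric.mem_closure_iff.1
    (mem_closure_convexHull_small_slices hK ⟨x, hx, rfl⟩ (half_pos hδ)) (δ / 2) (half_pos hδ)
  obtain ⟨ι, _, z, w, hzr, -, hw, hw1, rfl⟩ := eq_pos_convex_span_of_mem_convexHull hp
  have hz := fun i => hzr (Set.mem_range_self i)
  choose hzK v a haz hsmall using hz
  choose s hsA hsz using hzK
  choose f hf using fun i => exists_clm_re_eq 𝕜 ((innerSL ℝ (v i)).comp T)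
  refine ⟨_, isConvexCombinationOfSlices_of_fintype hw hw1 fun i =>
    isSlice_of_mem_of_lt hA (f i) (a := a i) (hsA i) (by simpa [hf, hsz] using haz i), ?_⟩
  rintro _ ⟨y, hy, rfl⟩
  have h1 : ‖T (∑ i, w i • y i) - ∑ i, w i • z i‖ ≤ δ / 2 := by
    rw [map_sum, ← Finset.sum_sub_distrib]
    calc ‖∑ i, (T (w i • y i) - w i • z i)‖ ≤ ∑ i, w i * (δ / 2) := by
          refine norm_sum_le_of_le _ fun i _ => ?_
          rw [map_smul, ← smul_sub, norm_smul, Real.norm_of_nonneg (hw i).le]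
          have := hsmall i (T (y i)) ⟨y i, (hy i).1, rfl⟩ (by simpa [hf] using (hy i).2)
          exact mul_le_mul_of_nonneg_left this.le (hw i).le
      _ = δ / 2 := by rw [← Finset.sum_mul, hw1, one_mul]
  rw [dist_comm, dist_eq_norm] at hpx
  calc _ ≤ ‖T (∑ i, w i • y i) - ∑ i, w i • z i‖ + ‖∑ i, w i • z i - T x‖ :=
        norm_sub_le_norm_sub_add_norm_sub _ _ _
    _ < δ := by linarith

theorem exists_finset_forall_mem_of_mem_nhds_toWeakSpace {𝕜 : Type*} [RCLike 𝕜] {X : Type*}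
    [NormedAddCommGroup X] [NormedSpace 𝕜 X] {U : Set (WeakSpace 𝕜 X)} {x : X}
    (hU : U ∈ nhds (toWeakSpace 𝕜 X x)) :
    ∃ (F : Finset (X →L[𝕜] 𝕜)) (r : ℝ), 0 < r ∧
      ∀ y, (∀ f ∈ F, ‖f y - f x‖ < r) → toWeakSpace 𝕜 X y ∈ U := by
  have h1 : U ∈ Filter.comap (fun y : WeakSpace 𝕜 X => fun f : X →L[𝕜] 𝕜 => f y)
      (nhds fun f : X →L[𝕜] 𝕜 => f x) :=
    (nhds_induced (fun (y : WeakSpace 𝕜 X) (f : X →L[𝕜] 𝕜) => f y) (toWeakSpace 𝕜 X x)) ▸ hU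
  obtain ⟨V, hV, hVU⟩ := h1
  rw [nhds_pi, Filter.mem_pi'] at hV
  obtain ⟨F, t, ht, htV⟩ := hV
  have h2 : ∀ f : X →L[𝕜] 𝕜, ∃ r > 0, Metric.ball (f x) r ⊆ t f :=
    fun f => Metric.mem_nhds_iff.1 (ht f)
  choose r hr hrt using h2
  obtain ⟨ρ, hρ, hρr⟩ : ∃ ρ > 0, ∀ f ∈ F, ρ ≤ r f := by
    rcases F.eq_empty_or_nonempty with rfl | hF
    · exact ⟨1, one_pos, by simp⟩
    · refine ⟨F.inf' hF r, (Finset.lt_inf'_iff hF).2 fun f _ => hr f,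
        fun f hf => Finset.inf'_le r hf⟩
  refine ⟨F, ρ, hρ, fun y hy => hVU (htV fun f hf => hrt f ?_)⟩
  rw [Metric.mem_ball, dist_eq_norm]
  exact (hy f hf).trans_le (hρr f hf)

/-- Bourgain's lemma: a non-empty relatively weakly open subset of a bounded convex set contains
a convex combination of slices. -/
theorem exists_isConvexCombinationOfSlices_subset_of_isOpen {A : Set X} (hconv : Convex ℝ A)
    (hA : Bornology.IsBounded A) {U : Set (WeakSpace 𝕜 X)} (hU : IsOpen U) {x : X} (hx : x ∈ A)
    (hxU : toWeakSpace 𝕜 X x ∈ U) :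
    ∃ C, IsConvexCombinationOfSlices 𝕜 A C ∧ C ⊆ {y | y ∈ A ∧ toWeakSpace 𝕜 X y ∈ U} := by
  obtain ⟨F, r, hr, hF⟩ := exists_finset_forall_mem_of_mem_nhds_toWeakSpace (hU.mem_nhds hxU)
  -- The ℓ² norm makes the target a Hilbert space and still dominates every coordinate.
  let T : X →L[ℝ] PiLp 2 (fun _ : F => 𝕜) :=
    ((PiLp.continuousLinearEquiv 2 ℝ (fun _ : F => 𝕜)).symm : (F → 𝕜) →L[ℝ] _).comp
      (ContinuousLinearMap.pi fun f : F => (f : X →L[𝕜] 𝕜).restrictScalars ℝ)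
  obtain ⟨C, hC, hCT⟩ := exists_isConvexCombinationOfSlices_map_mem_ball (𝕜 := 𝕜) hA T hx hr
  refine ⟨C, hC, fun y hy => ⟨hC.subset hconv hy, hF y fun f hf => ?_⟩⟩
  exact (PiLp.norm_apply_le (T y - T x) ⟨f, hf⟩).trans_lt (hCT y hy)

theorem isOpen_toWeakSpace_lt_re {𝕜 : Type*} [RCLike 𝕜] {X : Type*} [NormedAddCommGroup X]
    [NormedSpace 𝕜 X] (f : X →L[𝕜] 𝕜) (a : ℝ) :
    IsOpen {y : WeakSpace 𝕜 X | a < RCLike.re (f ((toWeakSpace 𝕜 X).symm y))} := by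
  have h : Continuous fun y : WeakSpace 𝕜 X => f ((toWeakSpace 𝕜 X).symm y) :=
    WeakBilin.eval_continuous (topDualPairing 𝕜 X).flip f
  exact isOpen_lt continuous_const (RCLike.continuous_re.comp h)

theorem IsSlice.exists_eq_lt {𝕜 : Type*} [RCLike 𝕜] {X : Type*} [NormedAddCommGroup X]
    [NormedSpace 𝕜 X] {A S : Set X} (hS : IsSlice 𝕜 A S) :
    ∃ (f : X →L[𝕜] 𝕜) (a : ℝ), S = {y | y ∈ A ∧ a < RCLike.re (f y)} := by
  obtain ⟨f, ε, -, rfl⟩ := hS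
  exact ⟨f, _, rfl⟩

theorem IsSlice.convex {A S : Set X} (hconv : Convex ℝ A) (hS : IsSlice 𝕜 A S) :
    Convex ℝ S := by
  obtain ⟨f, a, rfl⟩ := hS.exists_eq_lt
  exact hconv.inter (convex_halfSpace_gt (isLinearMap_re_clm f) a)

/-- A slice of a slice `S` of `A` need not be a slice of `A`, but it is the trace on `A` of two open
half-spaces. Bourgain's lemma therefore replaces each summand of a small combination in `S` by a
combination of slices of `A`. -/
theorem IsStronglyRegular.hasSmallCombinationsOfSlices {A : Set X} (hconv : Convex ℝ A)
    (hA : Bornology.IsBounded A) (h : IsStronglyRegular 𝕜 A) :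
    HasSmallCombinationsOfSlices 𝕜 A := by
  intro S hS δ hδ
  rcases A.eq_empty_or_nonempty with rfl | hne
  · have : S = ∅ := Set.subset_empty_iff.1 hS.subset
    exact ⟨S, hS.isConvexCombinationOfSlices, subset_rfl, by simpa [this]⟩
  obtain ⟨_, ⟨m, w, R, hw, hw1, hR, rfl⟩, hsub, hdiam⟩ :=
    h S hS.subset (hS.nonempty hne) (hS.convex hconv) δ hδ
  obtain ⟨C, hC, hCsub⟩ := exists_isConvexCombinationOfSlices_subset_sum (𝕜 := 𝕜) (A := A)
    (W := R) hw hw1 fun i => by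
      obtain ⟨x, hx⟩ := (hR i).nonempty (hS.nonempty hne)
      obtain ⟨f, a, rfl⟩ := hS.exists_eq_lt
      obtain ⟨g, b, hg⟩ := (hR i).exists_eq_lt
      rw [hg] at hx ⊢
      obtain ⟨C, hC, hCs⟩ := exists_isConvexCombinationOfSlices_subset_of_isOpen hconv hA
        ((isOpen_toWeakSpace_lt_re f a).inter (isOpen_toWeakSpace_lt_re g b)) hx.1.1
        ⟨by simpa using hx.1.2, by simpa using hx.2⟩
      refine ⟨C, hC, fun y hy => ?_⟩
      simpa [and_assoc] using hCs hy
  exact ⟨C, hC, hCsub.trans hsub,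
    (Metric.diam_mono hCsub (hA.subset (hsub.trans hS.subset))).trans_lt hdiam⟩

theorem HasCPCP.hasSmallCombinationsOfSlices {A : Set X} (hclosed : IsClosed A)
    (hconv : Convex ℝ A) (hA : Bornology.IsBounded A) (h : HasCPCP 𝕜 A) :
    HasSmallCombinationsOfSlices 𝕜 A := by
  intro S hS δ hδ
  rcases A.eq_empty_or_nonempty with rfl | hne
  · have : S = ∅ := Set.subset_empty_iff.1 hS.subset
    exact ⟨S, hS.isConvexCombinationOfSlices, subset_rfl, by simpa [this]⟩
  obtain ⟨z, hzS⟩ := hS.nonempty hne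
  obtain ⟨f, a, rfl⟩ := hS.exists_eq_lt
  -- CPCP needs a closed set, so the slice is shrunk to the closed slice at level `b`, with `z`
  -- strictly inside.
  obtain ⟨b, hab, hbz⟩ := exists_between hzS.2
  let B : Set X := {y | y ∈ A ∧ b ≤ RCLike.re (f y)}
  have hBconv : Convex ℝ B :=
    hconv.inter (convex_halfSpace_ge (isLinearMap_re_clm f) b)
  have hBclosed : IsClosed B :=
    hclosed.inter (isClosed_le continuous_const (RCLike.continuous_re.comp f.continuous))
  obtain ⟨x, hxB, hx⟩ := h B (fun y hy => hy.1) ⟨z, hzS.1, hbz.le⟩ hBconv hBclosed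
  have hball : {y : WeakSpace 𝕜 X | dist ((toWeakSpace 𝕜 X).symm y) x < δ / 3} ∈
      nhdsWithin (toWeakSpace 𝕜 X x) (toWeakSpace 𝕜 X '' B) := by
    exact hx (Metric.ball_mem_nhds _ (show 0 < δ / 3 by positivity))
  obtain ⟨U, hUo, hxU, hU⟩ := mem_nhdsWithin.1 hball
  -- The continuity point `x` may lie on the face `Re f = b`. A small move towards `z` stays in `U`
  -- and enters the open half-space, so the weakly open set given to Bourgain's lemma meets `A`.
  have hsegcont : Continuous fun t : ℝ => (x + t • (z - x) : X) := by fun_prop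
  have hev : ∀ᶠ t in nhdsWithin (0 : ℝ) (Set.Ioi 0),
      toWeakSpace 𝕜 X (x + t • (z - x)) ∈ U := by
    have hc : Continuous fun t : ℝ => toWeakSpace 𝕜 X (x + t • (z - x)) :=
      (toWeakSpaceCLM 𝕜 X).continuous.comp hsegcont
    refine nhdsWithin_le_nhds (hc.continuousAt.eventually_mem (hUo.mem_nhds ?_))
    simpa using hxU
  obtain ⟨t, htU, ht0, ht1⟩ := (hev.and (Ioo_mem_nhdsGT (zero_lt_one' ℝ))).exists
  have hpA : x + t • (z - x) ∈ A := hconv.add_smul_sub_mem hxB.1 hzS.1 ⟨ht0.le, ht1.le⟩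
  have hpf : b < RCLike.re (f (x + t • (z - x))) := by
    have h1 := (isLinearMap_re_clm f).map_add x (t • (z - x))
    rw [(isLinearMap_re_clm f).map_smul, (isLinearMap_re_clm f).map_sub, smul_eq_mul] at h1
    rw [h1]
    nlinarith [hxB.2]
  obtain ⟨C, hC, hCs⟩ := exists_isConvexCombinationOfSlices_subset_of_isOpen hconv hA
    ((isOpen_toWeakSpace_lt_re f b).inter hUo) hpA ⟨by simpa using hpf, htU⟩
  have hCB : C ⊆ B := fun y hy => ⟨(hCs hy).1, by simpa using (hCs hy).2.1.le⟩
  refine ⟨C, hC, fun y hy => ⟨(hCB hy).1, hab.trans_le (hCB hy).2⟩, ?_⟩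
  have hd : ∀ y ∈ C, dist y x ≤ δ / 3 := fun y hy => by
    have := hU ⟨(hCs hy).2.2, y, hCB hy, rfl⟩
    simpa using this.le
  refine (Metric.diam_le_of_forall_dist_le (C := 2 * (δ / 3)) (by positivity)
    fun y hy y' hy' => ?_).trans_lt (by linarith)
  linarith [dist_triangle_right y y' x, hd y hy, hd y' hy']

end WeaklyOpen

/-! ### Convex combinations with equal weights -/

section UniformAverages

variable {X : Type*} [NormedAddCommGroup X] [NormedSpace ℝ X]

/-- Averages, with equal weights, of finite families (with repetitions) of elements of `D`. -/
def uniformAverages (D : Set X) : Set X :=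
  {p | ∃ s : Multiset X, s ≠ 0 ∧ (∀ d ∈ s, d ∈ D) ∧ p = (s.card : ℝ)⁻¹ • s.sum}

theorem rational_combo_mem_uniformAverages {D : Set X} {p q : X} (hp : p ∈ uniformAverages D)
    (hq : q ∈ uniformAverages D) {k K : ℕ} (hK : 0 < K) (hk : k ≤ K) :
    ((k : ℝ) / K) • p + (1 - (k : ℝ) / K) • q ∈ uniformAverages D := by
  obtain ⟨s, hs0, hsD, rfl⟩ := hp
  obtain ⟨t, ht0, htD, rfl⟩ := hq
  have hs : 0 < s.card := Multiset.card_pos.2 hs0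
  have ht : 0 < t.card := Multiset.card_pos.2 ht0
  have hcard : ((k * t.card) • s + ((K - k) * s.card) • t).card = K * (s.card * t.card) := by
    simp only [Multiset.card_add, Multiset.card_nsmul]
    obtain ⟨l, rfl⟩ := Nat.exists_eq_add_of_le hk
    simp only [Nat.add_sub_cancel_left]
    ring
  -- Repetitions put both averages over the common denominator `K * (s.card * t.card)`.
  refine ⟨(k * t.card) • s + ((K - k) * s.card) • t, ?_, ?_, ?_⟩
  · rw [← Multiset.card_pos, hcard]
    positivity
  · intro d hd
    rcases Multiset.mem_add.1 hd with h | h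
    · exact hsD d (Multiset.mem_of_mem_nsmul h)
    · exact htD d (Multiset.mem_of_mem_nsmul h)
  · rw [hcard, Multiset.sum_add, Multiset.sum_nsmul, Multiset.sum_nsmul, ← Nat.cast_smul_eq_nsmul ℝ,
      ← Nat.cast_smul_eq_nsmul ℝ, smul_add, smul_smul, smul_smul, smul_smul, smul_smul]
    have h1 : (s.card : ℝ) ≠ 0 := by positivity
    have h2 : (t.card : ℝ) ≠ 0 := by positivity
    have h3 : (K : ℝ) ≠ 0 := by positivity
    congr 2
    · push_cast
      field_simp
    · push_cast [Nat.cast_sub hk]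
      field_simp

theorem convexHull_subset_closure_uniformAverages (D : Set X) :
    convexHull ℝ D ⊆ closure (uniformAverages D) := by
  refine convexHull_min (fun d hd => subset_closure ⟨{d}, by simp, by simpa, by simp⟩) ?_
  intro p hp q hq a b ha hb hab
  obtain rfl : b = 1 - a := by linarith
  have ha1 : a ≤ 1 := by linarith
  have hcont : Continuous (Function.uncurry fun p q : X => a • p + (1 - a) • q) := by
    unfold Function.uncurry
    fun_prop
  rw [← closure_closure]
  refine map_mem_closure₂ (f := fun p q : X => a • p + (1 - a) • q) hcont hp hq
    fun p hp q hq => ?_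
  have hlim : Filter.Tendsto (fun K : ℕ => (⌊a * (K : ℝ)⌋₊ : ℝ) / (K : ℝ)) Filter.atTop (nhds a) :=
    (tendsto_nat_floor_mul_div_atTop ha).comp tendsto_natCast_atTop_atTop
  refine mem_closure_of_tendsto ((hlim.smul_const p).add ((hlim.const_sub 1).smul_const q)) ?_
  filter_upwards [Filter.eventually_gt_atTop 0] with K hK
  refine rational_combo_mem_uniformAverages hp hq hK (Nat.floor_le_of_le ?_)
  exact mul_le_of_le_one_left (by positivity) ha1

/-- Repeating a family does not change its average, so the finitely many families can be given a
common size, a multiple of all their cardinalities. This lets a whole level of the bush split into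
intervals of equal length. -/
theorem exists_common_uniform_average {M : ℕ} {x : ℕ → X} {D : ℕ → Set X}
    (h : ∀ j < M, x j ∈ closure (convexHull ℝ (D j))) {η : ℝ} (hη : 0 < η) :
    ∃ N : ℕ, 2 ≤ N ∧ ∃ z : ℕ → ℕ → X, ∀ j < M, (∀ b < N, z j b ∈ D j) ∧
      ‖∑ b ∈ Finset.range N, (z j b - x j)‖ ≤ N * η := by
  have h1 : ∀ j, ∃ s : Multiset X, j < M → s ≠ 0 ∧ (∀ d ∈ s, d ∈ D j) ∧
      ‖(s.card : ℝ)⁻¹ • s.sum - x j‖ ≤ η := by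
    intro j
    by_cases hj : j < M
    · have := closure_minimal (convexHull_subset_closure_uniformAverages (D j)) isClosed_closure
        (h j hj)
      obtain ⟨_, ⟨s, hs0, hsD, rfl⟩, hs⟩ := Metric.mem_closure_iff.1 this η hη
      rw [dist_comm, dist_eq_norm] at hs
      exact ⟨s, fun _ => ⟨hs0, hsD, hs.le⟩⟩
    · exact ⟨0, fun h => absurd h hj⟩
  choose s hs using h1
  have hpos : ∀ j < M, 0 < (s j).card := fun j hj => Multiset.card_pos.2 (hs j hj).1
  have hprod : 0 < ∏ j ∈ Finset.range M, (s j).card :=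
    Finset.prod_pos fun j hj => hpos j (Finset.mem_range.1 hj)
  -- The factor 2 ensures `2 ≤ N`, so that the grids of the bush become arbitrarily fine.
  refine ⟨2 * ∏ j ∈ Finset.range M, (s j).card, by omega, ?_⟩
  generalize hN : 2 * ∏ j ∈ Finset.range M, (s j).card = N
  have hN0 : 0 < N := by omega
  have h2 : ∀ j, ∃ z : ℕ → X, j < M → (∀ b < N, z b ∈ D j) ∧
      ‖∑ b ∈ Finset.range N, (z b - x j)‖ ≤ N * η := by
    intro j
    by_cases hj : j < M
    swap
    · exact ⟨0, fun h => absurd h hj⟩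
    obtain ⟨K, hK⟩ : (s j).card ∣ N := by
      rw [← hN]
      exact Dvd.dvd.mul_left (Finset.dvd_prod_of_mem _ (Finset.mem_range.2 hj)) _
    let l := (K • s j).toList
    have hl : l.length = N := by simp [l, hK, mul_comm]
    refine ⟨fun b => l.getD b 0, fun _ => ⟨fun b hb => ?_, ?_⟩⟩
    · simp only
      rw [List.getD_eq_getElem _ _ (hl ▸ hb)]
      refine (hs j hj).2.1 _ (Multiset.mem_of_mem_nsmul (n := K) ?_)
      exact Multiset.mem_toList.1 (List.getElem_mem _)
    · have hsum : ∑ b ∈ Finset.range N, l.getD b 0 = (K : ℝ) • (s j).sum := by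
        rw [Nat.cast_smul_eq_nsmul, ← Multiset.sum_nsmul, ← Multiset.sum_toList,
          ← Fin.sum_univ_getElem, ← hl, Finset.sum_range]
        exact Finset.sum_congr rfl fun i _ => List.getD_eq_getElem _ _ i.2
      have hc := hpos j hj
      rw [Finset.sum_sub_distrib, hsum, Finset.sum_const, Finset.card_range,
        ← Nat.cast_smul_eq_nsmul ℝ]
      have : (K : ℝ) • (s j).sum - (N : ℝ) • x j
          = (N : ℝ) • (((s j).card : ℝ)⁻¹ • (s j).sum - x j) := by
        rw [smul_sub, smul_smul, hK]
        congr 2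
        push_cast
        field_simp
      rw [this, norm_smul, Real.norm_natCast]
      gcongr
      exact (hs j hj).2.2
  choose z hz using h2
  exact ⟨z, hz⟩

end UniformAverages

/-! ### Construction of separated bushes -/

section Bush

variable {X : Type*} [NormedAddCommGroup X] [NormedSpace ℝ X]

/-- A `δ`-separated approximate bush in `A`: the `n`-th level consists of the points `x n j`,
`j < M n`, and the point `x n j` is, up to `2⁻ⁿ`, the average of its `N n` children
`x (n + 1) (j * N n + b)`, each of which is at distance at least `δ` from it. -/
structure IsBush (A : Set X) (δ : ℝ) (M N : ℕ → ℕ) (x : ℕ → ℕ → X) : Prop where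
  pos : ∀ n, 0 < M n
  two_le : ∀ n, 2 ≤ N n
  succ : ∀ n, M (n + 1) = M n * N n
  mem : ∀ n, ∀ j < M n, x n j ∈ A
  separated : ∀ n, ∀ j < M (n + 1), δ ≤ ‖x (n + 1) j - x n (j / N n)‖
  average : ∀ n, ∀ j < M n,
    ‖∑ b ∈ Finset.range (N n), (x (n + 1) (j * N n + b) - x n j)‖ ≤ N n * (1 / 2) ^ n

theorem exists_isBush {L : Set X} (hne : L.Nonempty) {δ : ℝ}
    (h : ∀ x ∈ L, x ∈ closure (convexHull ℝ {y | y ∈ L ∧ δ ≤ ‖y - x‖})) :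
    ∃ M N x, IsBush L δ M N x := by
  have hstep : ∀ (n : ℕ) (p : {p : ℕ × (ℕ → X) // 0 < p.1 ∧ ∀ j < p.1, p.2 j ∈ L}),
      ∃ (p' : {p : ℕ × (ℕ → X) // 0 < p.1 ∧ ∀ j < p.1, p.2 j ∈ L}) (N : ℕ), 2 ≤ N ∧
        p'.1.1 = p.1.1 * N ∧ (∀ j < p'.1.1, δ ≤ ‖p'.1.2 j - p.1.2 (j / N)‖) ∧
        ∀ j < p.1.1, ‖∑ b ∈ Finset.range N, (p'.1.2 (j * N + b) - p.1.2 j)‖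
          ≤ N * (1 / 2) ^ n := by
    rintro n ⟨⟨M, x⟩, hM, hx⟩
    obtain ⟨N, hN, z, hz⟩ := exists_common_uniform_average (M := M) (x := x)
      (D := fun j => {y | y ∈ L ∧ δ ≤ ‖y - x j‖}) (fun j hj => h _ (hx j hj))
      (η := (1 / 2) ^ n) (by positivity)
    have hN0 : 0 < N := by omega
    have hdiv : ∀ j < M * N, j / N < M := fun j hj => Nat.div_lt_of_lt_mul (by rwa [mul_comm])
    -- Index `j` of the new level encodes the parent `j / N` and the child number `j % N`.
    refine ⟨⟨⟨M * N, fun j => z (j / N) (j % N)⟩, by positivity, fun j hj => ?_⟩, N, hN, rfl,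
      fun j hj => ?_, fun j hj => ?_⟩
    · exact ((hz _ (hdiv j hj)).1 _ (Nat.mod_lt _ hN0)).1
    · exact ((hz _ (hdiv j hj)).1 _ (Nat.mod_lt _ hN0)).2
    · refine le_of_eq_of_le (congrArg norm (Finset.sum_congr rfl fun b hb => ?_)) (hz j hj).2
      have hb := Finset.mem_range.1 hb
      simp only
      rw [Nat.mul_comm j N, Nat.mul_add_div hN0, Nat.div_eq_of_lt hb, Nat.mul_add_mod,
        Nat.mod_eq_of_lt hb, add_zero]
  choose next N hN hsucc hsep havg using hstep
  obtain ⟨x₀, hx₀⟩ := hne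
  let p : ℕ → {p : ℕ × (ℕ → X) // 0 < p.1 ∧ ∀ j < p.1, p.2 j ∈ L} :=
    fun n => Nat.rec ⟨(1, fun _ => x₀), one_pos, fun _ _ => hx₀⟩ (fun n p => next n p) n
  exact ⟨fun n => (p n).1.1, fun n => N n (p n), fun n => (p n).1.2,
    { pos := fun n => (p n).2.1
      two_le := fun n => hN n (p n)
      succ := fun n => hsucc n (p n)
      mem := fun n => (p n).2.2
      separated := fun n => hsep n (p n)
      average := fun n => havg n (p n) }⟩

end Bush

/-! ### Step functions on uniform grids of `[0, 1)` -/

section StepFunctions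

/-- Lebesgue measure on `[0, 1)`. -/
noncomputable abbrev unitVolume : Measure ℝ := volume.restrict (Set.Ico 0 1)

instance isProbabilityMeasure_unitVolume : IsProbabilityMeasure unitVolume :=
  ⟨by simp [unitVolume]⟩

/-- The index of the interval `[j / M, (j + 1) / M)` that contains `t`. -/
noncomputable def gridIndex (M : ℕ) (t : ℝ) : ℕ := ⌊t * M⌋₊

theorem measurable_gridIndex (M : ℕ) : Measurable (gridIndex M) :=
  Nat.measurable_floor.comp (measurable_id.mul_const _)

theorem gridIndex_lt {M : ℕ} (hM : 0 < M) {t : ℝ} (ht : t ∈ Set.Ico (0 : ℝ) 1) :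
    gridIndex M t < M := by
  have hM' : (0 : ℝ) < M := by exact_mod_cast hM
  rw [gridIndex, Nat.floor_lt (mul_nonneg ht.1 hM'.le)]
  nlinarith [ht.2]

theorem gridIndex_mul_div (M : ℕ) {N : ℕ} (hN : 0 < N) (t : ℝ) :
    gridIndex (M * N) t / N = gridIndex M t := by
  have hN' : (N : ℝ) ≠ 0 := by positivity
  rw [gridIndex, gridIndex, ← Nat.floor_div_natCast]
  congr 1
  push_cast
  field_simp

theorem ae_gridIndex_lt {M : ℕ} (hM : 0 < M) : ∀ᵐ t ∂unitVolume, gridIndex M t < M := by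
  filter_upwards [ae_restrict_mem measurableSet_Ico] with t ht using gridIndex_lt hM ht

variable {E : Type*} [NormedAddCommGroup E]

theorem aestronglyMeasurable_comp_gridIndex (F : ℕ → E) (M : ℕ) :
    AEStronglyMeasurable (fun t => F (gridIndex M t)) unitVolume :=
  (StronglyMeasurable.of_discrete (f := F)).comp_measurable (measurable_gridIndex M)
    |>.aestronglyMeasurable

theorem integrable_comp_gridIndex (F : ℕ → E) {M : ℕ} (hM : 0 < M) :
    Integrable (fun t => F (gridIndex M t)) unitVolume := by
  refine Integrable.of_bound (aestronglyMeasurable_comp_gridIndex F M)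
    (∑ j ∈ Finset.range M, ‖F j‖) ?_
  filter_upwards [ae_gridIndex_lt hM] with t ht
  exact Finset.single_le_sum (f := fun j => ‖F j‖) (fun _ _ => norm_nonneg _)
    (Finset.mem_range.2 ht)

theorem integral_comp_gridIndex [NormedSpace ℝ E] [CompleteSpace E] (F : ℕ → E) {M : ℕ}
    (hM : 0 < M) :
    ∫ t, F (gridIndex M t) ∂unitVolume = (M : ℝ)⁻¹ • ∑ j ∈ Finset.range M, F j := by
  have hM' : (0 : ℝ) < M := by exact_mod_cast hM
  have hpre : ∀ j < M, gridIndex M ⁻¹' {j} ∩ Set.Ico (0 : ℝ) 1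
      = Set.Ico ((j : ℝ) / M) ((j + 1 : ℝ) / M) := by
    intro j hj
    have hj' : (j + 1 : ℝ) ≤ M := by exact_mod_cast hj
    ext t
    simp only [Set.mem_inter_iff, Set.mem_preimage, Set.mem_singleton_iff, Set.mem_Ico, gridIndex,
      div_le_iff₀ hM', lt_div_iff₀ hM']
    constructor
    · rintro ⟨h1, h2, h3⟩
      exact (Nat.floor_eq_iff (by positivity)).1 h1
    · rintro ⟨h1, h2⟩
      have h0 : 0 ≤ t * M := (Nat.cast_nonneg j).trans h1
      refine ⟨(Nat.floor_eq_iff h0).2 ⟨h1, h2⟩, nonneg_of_mul_nonneg_left h0 hM', ?_⟩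
      by_contra hcon
      nlinarith
  have hmeas : ∀ j < M, unitVolume.real (gridIndex M ⁻¹' {j}) = (M : ℝ)⁻¹ := by
    intro j hj
    rw [measureReal_restrict_apply (measurable_gridIndex M (measurableSet_singleton j)),
      hpre j hj, Real.volume_real_Ico_of_le (by gcongr; linarith)]
    field_simp
    ring
  calc ∫ t, F (gridIndex M t) ∂unitVolume
      = ∫ t, ∑ j ∈ Finset.range M, (gridIndex M ⁻¹' {j}).indicator (fun _ => F j) t
          ∂unitVolume := by
        refine integral_congr_ae ?_
        filter_upwards [ae_gridIndex_lt hM] with t ht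
        rw [Finset.sum_eq_single_of_mem (gridIndex M t) (Finset.mem_range.2 ht)]
        · simp
        · intro j _ hj
          simp [Ne.symm hj]
    _ = ∑ j ∈ Finset.range M, (M : ℝ)⁻¹ • F j := by
        rw [integral_finsetSum _ fun j _ => (integrable_const (F j)).indicator
          (measurable_gridIndex M (measurableSet_singleton j))]
        refine Finset.sum_congr rfl fun j hj => ?_
        rw [integral_indicator_const _ (measurable_gridIndex M (measurableSet_singleton j)),
          hmeas j (Finset.mem_range.1 hj)]
    _ = _ := (Finset.smul_sum ..).symm

/-- Approximate `g` in L¹ by a uniformly continuous function and sample the latter at left endpoints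
of a fine grid. -/
theorem exists_gridIndex_integral_sub_le [NormedSpace ℝ E] {g : ℝ → E}
    (hg : Integrable g unitVolume) {M : ℕ → ℕ} (hM : Filter.Tendsto M Filter.atTop Filter.atTop)
    {θ : ℝ} (hθ : 0 < θ) :
    ∀ᶠ n in Filter.atTop, ∃ y : ℕ → E, ∫ t, ‖g t - y (gridIndex (M n) t)‖ ∂unitVolume ≤ θ := by
  obtain ⟨c, hcs, hcg, hcc, hci⟩ := hg.exists_hasCompactSupport_integral_sub_le (half_pos hθ)
  obtain ⟨r, hr, hcr⟩ := Metric.uniformContinuous_iff.1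
    (hcs.uniformContinuous_of_continuous hcc) (θ / 2) (half_pos hθ)
  have hev : ∀ᶠ n in Filter.atTop, r⁻¹ < (M n : ℝ) :=
    (tendsto_natCast_atTop_atTop.comp hM).eventually_gt_atTop _
  filter_upwards [hev] with n hn
  have hM0 : (0 : ℝ) < M n := (inv_pos.2 hr).trans hn
  have hM0' : 0 < M n := by exact_mod_cast hM0
  refine ⟨fun j => c (j / M n), ?_⟩
  have hclose : ∀ᵐ t ∂unitVolume, ‖c t - c (gridIndex (M n) t / M n)‖ ≤ θ / 2 := by
    filter_upwards [ae_restrict_mem measurableSet_Ico] with t ht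
    rw [← dist_eq_norm]
    refine (hcr ?_).le
    have h0 : 0 ≤ t * M n := mul_nonneg ht.1 hM0.le
    have h1 : (gridIndex (M n) t : ℝ) ≤ t * M n := Nat.floor_le h0
    have h2 : t * M n < gridIndex (M n) t + 1 := Nat.lt_floor_add_one _
    have h3 : t - gridIndex (M n) t / M n = (t * M n - gridIndex (M n) t) / M n := by field_simp
    rw [Real.dist_eq, h3, abs_of_nonneg (div_nonneg (by linarith) hM0.le), div_lt_iff₀ hM0]
    have := (inv_lt_iff_one_lt_mul₀ hr).1 hn
    linarith
  have hyi := integrable_comp_gridIndex (fun j => c (j / M n)) hM0'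
  calc _ ≤ ∫ t, (‖g t - c t‖ + θ / 2) ∂unitVolume := by
        refine integral_mono_ae (hg.sub hyi).norm ((hg.sub hci).norm.add (integrable_const _)) ?_
        filter_upwards [hclose] with t ht
        exact (norm_sub_le_norm_sub_add_norm_sub _ (c t) _).trans (by gcongr)
    _ ≤ θ := by
        have h1 : Integrable (fun t => ‖g t - c t‖) unitVolume := (hg.sub hci).norm
        rw [integral_add h1 (integrable_const _), integral_const, probReal_univ, one_smul]
        linarith

end StepFunctions

theorem sum_range_mul_eq {V : Type*} [AddCommMonoid V] (G : ℕ → V) (M N : ℕ) :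
    ∑ j ∈ Finset.range (M * N), G j
      = ∑ a ∈ Finset.range M, ∑ b ∈ Finset.range N, G (a * N + b) := by
  induction M with
  | zero => simp
  | succ M ih => rw [Nat.succ_mul, Finset.sum_range_add, ih, Finset.sum_range_succ]

/-! ### Bushes as approximate martingales -/

section BushMartingale

variable {X : Type*} [NormedAddCommGroup X] {A : Set X} {δ : ℝ} {M N : ℕ → ℕ} {x : ℕ → ℕ → X}

theorem IsBush.tendsto (h : IsBush A δ M N x) : Filter.Tendsto M Filter.atTop Filter.atTop := by
  refine (strictMono_nat_of_lt_succ fun n => ?_).tendsto_atTop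
  rw [h.succ]
  have := h.pos n
  have := h.two_le n
  nlinarith

theorem IsBush.gridIndex_div (h : IsBush A δ M N x) (n : ℕ) (t : ℝ) :
    gridIndex (M (n + 1)) t / N n = gridIndex (M n) t := by
  rw [h.succ, gridIndex_mul_div _ (by have := h.two_le n; omega)]

variable [NormedSpace ℝ X] [CompleteSpace X]

/-- The weight is constant on each level-`n` interval, so the integral splits into the sums over
children controlled by `average`. -/
theorem IsBush.norm_integral_succ_le (h : IsBush A δ M N x) (n : ℕ) (y : ℕ → ℝ) :
    ‖∫ t, y (gridIndex (M n) t) • (x (n + 1) (gridIndex (M (n + 1)) t) - x n (gridIndex (M n) t))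
      ∂unitVolume‖ ≤ (1 / 2) ^ n * ∫ t, |y (gridIndex (M n) t)| ∂unitVolume := by
  have hN : 0 < N n := by have := h.two_le n; omega
  have hN' : (0 : ℝ) < N n := by exact_mod_cast hN
  simp_rw [← h.gridIndex_div n]
  rw [integral_comp_gridIndex (fun j => y (j / N n) • (x (n + 1) j - x n (j / N n)))
    (h.pos (n + 1)), norm_smul]
  simp_rw [h.gridIndex_div n]
  rw [integral_comp_gridIndex (fun j => |y j|) (h.pos n), h.succ, sum_range_mul_eq]
  have hinner : ∀ a ∈ Finset.range (M n), ‖∑ b ∈ Finset.range (N n), y ((a * N n + b) / N n) •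
      (x (n + 1) (a * N n + b) - x n ((a * N n + b) / N n))‖
        ≤ N n * (1 / 2) ^ n * |y a| := by
    intro a ha
    have hb : ∀ b ∈ Finset.range (N n), (a * N n + b) / N n = a := fun b hb => by
      rw [Nat.mul_comm, Nat.mul_add_div hN, Nat.div_eq_of_lt (Finset.mem_range.1 hb), add_zero]
    rw [Finset.sum_congr rfl fun b hb' => by rw [hb b hb'], ← Finset.smul_sum, norm_smul,
      Real.norm_eq_abs, mul_comm]
    gcongr
    exact h.average n a (Finset.mem_range.1 ha)
  calc _ ≤ ‖((M n * N n : ℕ) : ℝ)⁻¹‖ * ∑ a ∈ Finset.range (M n), N n * (1 / 2) ^ n * |y a| := by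
        gcongr
        exact norm_sum_le_of_le _ hinner
    _ = _ := by
        have := h.pos n
        rw [← Finset.mul_sum, norm_inv, Real.norm_natCast, smul_eq_mul]
        push_cast
        field_simp

/-- The conditional expectation, given the `n`-th level, of the `k`-th level of a bush differs
from the `n`-th level by at most `2 * 2⁻ⁿ - 2 * 2⁻ᵏ`. -/
theorem IsBush.norm_integral_sub_le (h : IsBush A δ M N x) {n k : ℕ} (hnk : n ≤ k)
    (y : ℕ → ℝ) :
    ‖∫ t, y (gridIndex (M n) t) • (x k (gridIndex (M k) t) - x n (gridIndex (M n) t))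
      ∂unitVolume‖
      ≤ (2 * (1 / 2) ^ n - 2 * (1 / 2) ^ k) * ∫ t, |y (gridIndex (M n) t)| ∂unitVolume := by
  have hrefine : ∀ k, n ≤ k → ∃ p : ℕ → ℕ, ∀ t, gridIndex (M n) t = p (gridIndex (M k) t) := by
    intro k hk
    induction k, hk using Nat.le_induction with
    | base => exact ⟨id, fun t => rfl⟩
    | succ k _ ih =>
      obtain ⟨p, hp⟩ := ih
      exact ⟨fun j => p (j / N k), fun t => by simp only [hp, h.gridIndex_div]⟩
  induction k, hnk using Nat.le_induction with
  | base => simp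
  | succ k hk ih =>
    obtain ⟨p, hp⟩ := hrefine k hk
    -- A step function of level `n` is also one of level `k`. The new error `2⁻ᵏ` equals `2 * 2⁻ᵏ -
    -- 2 * 2⁻ᵏ⁻¹`, so the bounds telescope.
    have h1 := h.norm_integral_succ_le k (y ∘ p)
    simp only [Function.comp_apply, ← hp] at h1
    have hI : ∀ l, n ≤ l → Integrable (fun t => y (gridIndex (M n) t) • x l (gridIndex (M l) t))
        unitVolume := by
      intro l hl
      obtain ⟨q, hq⟩ := hrefine l hl
      simp_rw [hq]
      exact integrable_comp_gridIndex (fun j => y (q j) • x l j) (h.pos l)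
    have hsplit : ∫ t, y (gridIndex (M n) t) •
        (x (k + 1) (gridIndex (M (k + 1)) t) - x n (gridIndex (M n) t)) ∂unitVolume
        = (∫ t, y (gridIndex (M n) t) •
          (x (k + 1) (gridIndex (M (k + 1)) t) - x k (gridIndex (M k) t)) ∂unitVolume)
        + ∫ t, y (gridIndex (M n) t) • (x k (gridIndex (M k) t) - x n (gridIndex (M n) t))
          ∂unitVolume := by
      simp_rw [smul_sub]
      rw [integral_sub (hI _ (by omega)) (hI _ le_rfl), integral_sub (hI _ (by omega)) (hI _ hk),
        integral_sub (hI _ hk) (hI _ le_rfl)]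
      abel
    rw [hsplit]
    refine (norm_add_le _ _).trans ((add_le_add h1 ih).trans (le_of_eq ?_))
    rw [pow_succ]
    ring

end BushMartingale

/-! ### The measure of a bush, and Radon–Nikodým sets -/

section RadonNikodym

variable {X : Type*} [NormedAddCommGroup X] {A : Set X} {δ : ℝ} {M N : ℕ → ℕ} {x : ℕ → ℕ → X}

theorem IsBush.integrable (h : IsBush A δ M N x) (n : ℕ) :
    Integrable (fun t => x n (gridIndex (M n) t)) unitVolume :=
  integrable_comp_gridIndex (x n) (h.pos n)

theorem IsBush.ae_mem (h : IsBush A δ M N x) (n : ℕ) :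
    ∀ᵐ t ∂unitVolume, x n (gridIndex (M n) t) ∈ A := by
  filter_upwards [ae_gridIndex_lt (h.pos n)] with t ht using h.mem n _ ht

variable [NormedSpace ℝ X] [CompleteSpace X]

/-- Replace `u` by a step function of some level `n`: boundedness of `A` controls the L¹ error
uniformly in later levels, and the martingale estimate handles the step function. -/
theorem IsBush.cauchySeq_integral_smul (h : IsBush A δ M N x) (hA : Bornology.IsBounded A)
    {u : ℝ → ℝ} (hu : Integrable u unitVolume) :
    CauchySeq fun n => ∫ t, u t • x n (gridIndex (M n) t) ∂unitVolume := by
  obtain ⟨B, hB0, hB⟩ := hA.exists_pos_norm_le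
  have hui : ∀ n, Integrable (fun t => u t • x n (gridIndex (M n) t)) unitVolume := fun n =>
    hu.smul_bdd B (h.integrable n).aestronglyMeasurable (by
      filter_upwards [h.ae_mem n] with t ht using hB _ ht)
  rw [Metric.cauchySeq_iff']
  intro ε hε
  obtain ⟨θ, hθ⟩ : ∃ θ, θ = ε / (8 * B) := ⟨_, rfl⟩
  have hθ0 : 0 < θ := by rw [hθ]; positivity
  have hθB : 2 * B * θ = ε / 4 := by rw [hθ]; field_simp; norm_num
  have hlim : Filter.Tendsto (fun n : ℕ => 2 * (1 / 2 : ℝ) ^ n *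
      ((∫ t, |u t| ∂unitVolume) + θ)) Filter.atTop (nhds 0) := by
    have := ((tendsto_pow_atTop_nhds_zero_of_lt_one (r := (1 / 2 : ℝ)) (by norm_num)
      (by norm_num)).const_mul 2).mul_const ((∫ t, |u t| ∂unitVolume) + θ)
    simpa using this
  obtain ⟨n, ⟨y, hy⟩, hn⟩ := ((exists_gridIndex_integral_sub_le hu h.tendsto hθ0).and
    (hlim.eventually_lt_const (show 0 < ε / 2 by positivity))).exists
  refine ⟨n, fun k hk => ?_⟩
  have hyi := integrable_comp_gridIndex y (h.pos n)
  have hyx : ∀ l, Integrable (fun t => y (gridIndex (M n) t) • x l (gridIndex (M l) t))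
      unitVolume := fun l => hyi.smul_bdd B (h.integrable l).aestronglyMeasurable (by
        filter_upwards [h.ae_mem l] with t ht using hB _ ht)
  have hsplit : (∫ t, u t • x k (gridIndex (M k) t) ∂unitVolume)
      - ∫ t, u t • x n (gridIndex (M n) t) ∂unitVolume
      = (∫ t, (u t - y (gridIndex (M n) t)) •
          (x k (gridIndex (M k) t) - x n (gridIndex (M n) t)) ∂unitVolume)
        + ∫ t, y (gridIndex (M n) t) • (x k (gridIndex (M k) t) - x n (gridIndex (M n) t))
          ∂unitVolume := by
    rw [← integral_sub (hui k) (hui n), ← integral_add]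
    · refine integral_congr_ae (Filter.Eventually.of_forall fun t => ?_)
      simp only [sub_smul, smul_sub]
      abel
    · simp only [sub_smul, smul_sub]
      exact ((hui k).sub (hyx k)).sub ((hui n).sub (hyx n))
    · simp only [smul_sub]
      exact (hyx k).sub (hyx n)
  have h1 : ‖∫ t, (u t - y (gridIndex (M n) t)) •
      (x k (gridIndex (M k) t) - x n (gridIndex (M n) t)) ∂unitVolume‖ ≤ ε / 4 := by
    calc _ ≤ ∫ t, ‖u t - y (gridIndex (M n) t)‖ * (2 * B) ∂unitVolume := by
          refine norm_integral_le_of_norm_le ((hu.sub hyi).norm.mul_const _) ?_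
          filter_upwards [h.ae_mem k, h.ae_mem n] with t htk htn
          rw [norm_smul]
          gcongr
          linarith [norm_sub_le (x k (gridIndex (M k) t)) (x n (gridIndex (M n) t)), hB _ htk,
            hB _ htn]
      _ ≤ θ * (2 * B) := by
          rw [integral_mul_const]
          gcongr
      _ = ε / 4 := by rw [← hθB]; ring
  have hy1 : ∫ t, |y (gridIndex (M n) t)| ∂unitVolume ≤ (∫ t, |u t| ∂unitVolume) + θ := by
    calc _ ≤ ∫ t, (|u t| + ‖u t - y (gridIndex (M n) t)‖) ∂unitVolume := by
          refine integral_mono hyi.norm (hu.norm.add (hu.sub hyi).norm) fun t => ?_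
          simp only [Real.norm_eq_abs]
          linarith [abs_sub_abs_le_abs_sub (y (gridIndex (M n) t)) (u t),
            abs_sub_comm (u t) (y (gridIndex (M n) t))]
      _ ≤ _ := by
          have h1 : Integrable (fun t => |u t|) unitVolume := hu.norm
          have h2 : Integrable (fun t => ‖u t - y (gridIndex (M n) t)‖) unitVolume :=
            (hu.sub hyi).norm
          rw [integral_add h1 h2]
          gcongr
  have h2 : ‖∫ t, y (gridIndex (M n) t) • (x k (gridIndex (M k) t) - x n (gridIndex (M n) t))
      ∂unitVolume‖ ≤ 2 * (1 / 2) ^ n * ((∫ t, |u t| ∂unitVolume) + θ) := by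
    refine (h.norm_integral_sub_le hk y).trans ?_
    gcongr
    have : (0 : ℝ) ≤ 2 * (1 / 2) ^ k := by positivity
    linarith
  rw [dist_eq_norm, hsplit]
  linarith [norm_add_le (∫ t, (u t - y (gridIndex (M n) t)) •
          (x k (gridIndex (M k) t) - x n (gridIndex (M n) t)) ∂unitVolume)
        (∫ t, y (gridIndex (M n) t) • (x k (gridIndex (M k) t) - x n (gridIndex (M n) t))
          ∂unitVolume)]

/-- The vector measure generated by a bush in a bounded set. -/
theorem IsBush.exists_vectorMeasure (h : IsBush A δ M N x) (hA : Bornology.IsBounded A) :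
    ∃ m : VectorMeasure ℝ X, ∀ E, MeasurableSet E →
      Filter.Tendsto (fun n => ∫ t in E, x n (gridIndex (M n) t) ∂unitVolume) Filter.atTop
        (nhds (m E)) := by
  classical
  obtain ⟨B, hB0, hB⟩ := hA.exists_pos_norm_le
  have hlim : ∀ E, ∃ v : X, (MeasurableSet E →
      Filter.Tendsto (fun n => ∫ t in E, x n (gridIndex (M n) t) ∂unitVolume) Filter.atTop
        (nhds v)) ∧ (¬ MeasurableSet E → v = 0) := by
    intro E
    by_cases hE : MeasurableSet E
    · obtain ⟨v, hv⟩ := cauchySeq_tendsto_of_complete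
        (h.cauchySeq_integral_smul hA (u := E.indicator 1) ((integrable_const 1).indicator hE))
      refine ⟨v, fun _ => ?_, fun h => absurd hE h⟩
      refine hv.congr fun n => ?_
      rw [← integral_indicator hE]
      congr 1
      ext t
      by_cases ht : t ∈ E <;> simp [ht]
    · exact ⟨0, fun h => absurd h hE, fun _ => rfl⟩
  choose m hm hm0 using hlim
  have hfin : IsFiniteMeasure (ENNReal.ofReal B • unitVolume) :=
    unitVolume.smul_finite ENNReal.ofReal_ne_top
  -- Finite additivity passes to the limit; domination by `B` times Lebesgue measure upgrades it to
  -- countable additivity.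
  refine ⟨VectorMeasure.of_additive_of_le_measure (μ := ENNReal.ofReal B • unitVolume) m ?_ ?_ hm0,
    fun E hE => hm E hE⟩
  · intro E
    by_cases hE : MeasurableSet E
    swap
    · simp [hm0 E hE]
    have hle : ‖m E‖ ≤ B * unitVolume.real E := by
      refine le_of_tendsto (hm E hE).norm (Filter.Eventually.of_forall fun n => ?_)
      refine norm_setIntegral_le_of_norm_le_const_ae' (measure_lt_top _ _) ?_
      filter_upwards [h.ae_mem n] with t ht _ using hB _ ht
    rw [← ofReal_norm, Measure.smul_apply, smul_eq_mul]
    refine (ENNReal.ofReal_le_ofReal hle).trans ?_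
    rw [ENNReal.ofReal_mul hB0.le, ofReal_measureReal]
  · intro s t hs ht hst
    refine tendsto_nhds_unique (hm _ (hs.union ht)) (((hm s hs).add (hm t ht)).congr fun n => ?_)
    rw [setIntegral_union hst ht (h.integrable n).integrableOn (h.integrable n).integrableOn]

/-- On a grid interval `m` nearly has average `x n j`, while its density `g` is compared with `y j`;
summing bounds the distance from `x n` to `y`, and the triangle inequality adds the second copy of
the error. As `y` is arbitrary, the levels converge to `g` in L¹. -/
theorem IsBush.integral_norm_sub_le (h : IsBush A δ M N x) {m : VectorMeasure ℝ X}
    (hm : ∀ E, MeasurableSet E →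
      Filter.Tendsto (fun n => ∫ t in E, x n (gridIndex (M n) t) ∂unitVolume) Filter.atTop
        (nhds (m E)))
    {g : ℝ → X} (hg : Integrable g unitVolume)
    (hmg : ∀ E, MeasurableSet E → m E = ∫ t in E, g t ∂unitVolume) (n : ℕ) (y : ℕ → X) :
    ∫ t, ‖x n (gridIndex (M n) t) - g t‖ ∂unitVolume
      ≤ 2 * (1 / 2) ^ n + 2 * ∫ t, ‖g t - y (gridIndex (M n) t)‖ ∂unitVolume := by
  have hM : (0 : ℝ) < M n := by exact_mod_cast h.pos n
  have hyi := integrable_comp_gridIndex y (h.pos n)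
  have hgy : Integrable (fun t => g t - y (gridIndex (M n) t)) unitVolume := hg.sub hyi
  let I : ℕ → Set ℝ := fun j => gridIndex (M n) ⁻¹' {j}
  have hI : ∀ j, MeasurableSet (I j) := fun j => measurable_gridIndex _ (measurableSet_singleton j)
  have hPI : ∀ j < M n, unitVolume.real (I j) = (M n : ℝ)⁻¹ := fun j hj => by
    have h1 := integral_comp_gridIndex (fun i => if i = j then (1 : ℝ) else 0) (h.pos n)
    rw [Finset.sum_ite_eq' , if_pos (Finset.mem_range.2 hj), smul_eq_mul, mul_one] at h1
    rw [← h1, ← integral_indicator_one (hI j)]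
    congr 1
    ext t
    by_cases ht : gridIndex (M n) t = j <;> simp [I, ht]
  have hatom : ∀ j < M n, (M n : ℝ)⁻¹ * ‖x n j - y j‖
      ≤ 2 * (1 / 2) ^ n * (M n : ℝ)⁻¹ + ∫ t in I j, ‖g t - y (gridIndex (M n) t)‖ ∂unitVolume := by
    intro j hj
    have hconst : ∀ z : ℕ → X, ∫ t in I j, z (gridIndex (M n) t) ∂unitVolume
        = (M n : ℝ)⁻¹ • z j := by
      intro z
      rw [setIntegral_congr_fun (g := fun _ => z j) (hI j) fun t ht => congrArg z ht,
        setIntegral_const, hPI j hj]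
    have h1 : ‖m (I j) - (M n : ℝ)⁻¹ • x n j‖ ≤ 2 * (1 / 2) ^ n * (M n : ℝ)⁻¹ := by
      refine le_of_tendsto ((hm _ (hI j)).sub_const _).norm ?_
      filter_upwards [Filter.eventually_ge_atTop n] with k hk
      have h2 := h.norm_integral_sub_le hk (fun i => if i = j then (1 : ℝ) else 0)
      have h3 : ∫ t, |if gridIndex (M n) t = j then (1 : ℝ) else 0| ∂unitVolume
          = (M n : ℝ)⁻¹ := by
        rw [← hPI j hj, ← integral_indicator_one (hI j)]
        congr 1
        ext t
        by_cases ht : gridIndex (M n) t = j <;> simp [I, ht]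
      have h4 : ∫ t, (if gridIndex (M n) t = j then (1 : ℝ) else 0) •
          (x k (gridIndex (M k) t) - x n (gridIndex (M n) t)) ∂unitVolume
          = (∫ t in I j, x k (gridIndex (M k) t) ∂unitVolume) - (M n : ℝ)⁻¹ • x n j := by
        rw [← hconst (x n), ← integral_sub (h.integrable k).integrableOn
          (h.integrable n).integrableOn, ← integral_indicator (hI j)]
        congr 1
        ext t
        by_cases ht : gridIndex (M n) t = j <;> simp [I, ht]
      rw [h3, h4] at h2
      refine h2.trans ?_
      gcongr
      have : (0 : ℝ) ≤ 2 * (1 / 2) ^ k := by positivity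
      linarith
    have h5 : (M n : ℝ)⁻¹ • (x n j - y j) = -(m (I j) - (M n : ℝ)⁻¹ • x n j)
        + ∫ t in I j, (g t - y (gridIndex (M n) t)) ∂unitVolume := by
      rw [integral_sub hg.integrableOn hyi.integrableOn, hconst, hmg _ (hI j), smul_sub]
      abel
    calc (M n : ℝ)⁻¹ * ‖x n j - y j‖ = ‖(M n : ℝ)⁻¹ • (x n j - y j)‖ := by
          rw [norm_smul, norm_inv, Real.norm_natCast]
      _ ≤ _ := by
          rw [h5]
          refine (norm_add_le _ _).trans ?_
          rw [norm_neg]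
          exact add_le_add h1 (norm_integral_le_integral_norm _)
  have hsum : ∑ j ∈ Finset.range (M n), ∫ t in I j, ‖g t - y (gridIndex (M n) t)‖ ∂unitVolume
      ≤ ∫ t, ‖g t - y (gridIndex (M n) t)‖ ∂unitVolume := by
    rw [← integral_biUnion_finset _ (fun j _ => hI j) _ fun j _ => hgy.norm.integrableOn]
    · exact setIntegral_le_integral hgy.norm (Filter.Eventually.of_forall fun _ => norm_nonneg _)
    · intro i _ j _ hij
      exact Disjoint.preimage _ (Set.disjoint_singleton.2 hij)
  have hxy : ∫ t, ‖x n (gridIndex (M n) t) - y (gridIndex (M n) t)‖ ∂unitVolume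
      ≤ 2 * (1 / 2) ^ n + ∫ t, ‖g t - y (gridIndex (M n) t)‖ ∂unitVolume := by
    rw [integral_comp_gridIndex (fun j => ‖x n j - y j‖) (h.pos n), smul_eq_mul, Finset.mul_sum]
    refine (Finset.sum_le_sum fun j hj => hatom j (Finset.mem_range.1 hj)).trans ?_
    rw [Finset.sum_add_distrib, Finset.sum_const, Finset.card_range, nsmul_eq_mul]
    have : (M n : ℝ) * (2 * (1 / 2) ^ n * (M n : ℝ)⁻¹) = 2 * (1 / 2) ^ n := by field_simp
    rw [this]
    gcongr
  have hxyi : Integrable (fun t => ‖x n (gridIndex (M n) t) - y (gridIndex (M n) t)‖)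
    unitVolume := ((h.integrable n).sub hyi).norm
  calc _ ≤ ∫ t, (‖x n (gridIndex (M n) t) - y (gridIndex (M n) t)‖
        + ‖g t - y (gridIndex (M n) t)‖) ∂unitVolume := by
        refine integral_mono ((h.integrable n).sub hg).norm (hxyi.add hgy.norm) fun t => ?_
        simp only
        rw [norm_sub_rev (g t)]
        exact norm_sub_le_norm_sub_add_norm_sub _ _ _
    _ ≤ _ := by
        rw [integral_add hxyi hgy.norm]
        linarith

theorem IsRadonNikodymSet.not_isBush (hA : IsRadonNikodymSet A) (hclosed : IsClosed A)
    (hconv : Convex ℝ A) (hbdd : Bornology.IsBounded A) (hδ : 0 < δ) : ¬ IsBush A δ M N x := by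
  intro h
  obtain ⟨m, hm⟩ := h.exists_vectorMeasure hbdd
  obtain ⟨g, hg, hmg⟩ := hA ℝ unitVolume m
    (fun E hE hPE => by
      refine tendsto_nhds_unique (hm E hE) (tendsto_const_nhds.congr fun n => ?_)
      rw [setIntegral_measure_zero _ hPE])
    (fun E hE hPE => by
      refine hclosed.mem_of_tendsto ((hm E hE).const_smul _)
        (Filter.Eventually.of_forall fun n => ?_)
      -- Averages of functions with values in the closed convex set `A` stay in `A`, and so do their
      -- limits.
      have := hconv.set_average_mem hclosed hPE (measure_ne_top _ E)
        (ae_restrict_of_ae (h.ae_mem n)) (h.integrable n).integrableOn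
      rwa [setAverage_eq] at this)
  have hsmall : ∀ᶠ n in Filter.atTop,
      ∫ t, ‖x n (gridIndex (M n) t) - g t‖ ∂unitVolume < δ / 2 := by
    have hlim : Filter.Tendsto (fun n : ℕ => 2 * (1 / 2 : ℝ) ^ n) Filter.atTop (nhds 0) := by
      simpa using (tendsto_pow_atTop_nhds_zero_of_lt_one (r := (1 / 2 : ℝ)) (by norm_num)
        (by norm_num)).const_mul 2
    filter_upwards [exists_gridIndex_integral_sub_le hg h.tendsto (show 0 < δ / 8 by positivity),
      hlim.eventually_lt_const (show 0 < δ / 4 by positivity)] with n ⟨y, hy⟩ hn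
    linarith [h.integral_norm_sub_le hm hg hmg n y]
  obtain ⟨n, hn, hn'⟩ := (hsmall.and ((Filter.tendsto_add_atTop_nat 1).eventually hsmall)).exists
  have hi : ∀ k, Integrable (fun t => ‖x k (gridIndex (M k) t) - g t‖) unitVolume :=
    fun k => ((h.integrable k).sub hg).norm
  have hle : δ ≤ ∫ t, (‖x (n + 1) (gridIndex (M (n + 1)) t) - g t‖
      + ‖x n (gridIndex (M n) t) - g t‖) ∂unitVolume := by
    calc δ = ∫ _, δ ∂unitVolume := by simp
      _ ≤ _ := by
        refine integral_mono_ae (integrable_const _) ((hi (n + 1)).add (hi n)) ?_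
        filter_upwards [ae_gridIndex_lt (h.pos (n + 1))] with t ht
        have := h.separated n _ ht
        rw [h.gridIndex_div] at this
        refine this.trans ?_
        rw [norm_sub_rev (x n (gridIndex (M n) t)) (g t)]
        exact norm_sub_le_norm_sub_add_norm_sub _ _ _
  rw [integral_add (hi _) (hi _)] at hle
  linarith

/-- Single slices already suffice. If some `z ∈ L` is outside the closed convex hull of the points
of `L` at distance at least `δ / 3`, separation gives a slice within `δ / 3` of `z`, of diameter at
most `2 * (δ / 3) < δ`. Otherwise `L` carries a bush. -/
theorem IsRadonNikodymSet.isStronglyRegular {𝕜 : Type*} [RCLike 𝕜] [NormedSpace 𝕜 X]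
    [IsScalarTower ℝ 𝕜 X] (hA : IsRadonNikodymSet A) (hclosed : IsClosed A)
    (hconv : Convex ℝ A) (hbdd : Bornology.IsBounded A) : IsStronglyRegular 𝕜 A := by
  intro L hLA hne hL δ hδ
  by_contra! hcon
  have hfar : ∀ z ∈ L, z ∈ closure (convexHull ℝ {y | y ∈ L ∧ δ / 3 ≤ ‖y - z‖}) := by
    intro z hz
    by_contra hzc
    obtain ⟨S, hS, hdisj⟩ :=
      exists_slice_disjoint_convexHull (𝕜 := 𝕜) (hbdd.subset hLA) hz hzc
    have hSz : ∀ y ∈ S, dist y z ≤ δ / 3 := by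
      intro y hy
      by_contra! hlt
      rw [dist_eq_norm] at hlt
      exact Set.disjoint_left.1 hdisj hy (subset_convexHull ℝ _ ⟨hS.subset hy, hlt.le⟩)
    have hdiam : Metric.diam S ≤ 2 * (δ / 3) :=
      Metric.diam_le_of_forall_dist_le (by positivity) fun y hy y' hy' => by
        linarith [dist_triangle_right y y' z, hSz y hy, hSz y' hy']
    linarith [hcon S hS.isConvexCombinationOfSlices hS.subset]
  obtain ⟨M, N, x, h⟩ := exists_isBush hne hfar
  exact hA.not_isBush hclosed hconv hbdd (show 0 < δ / 3 by positivity)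
    { h with mem := fun n j hj => hLA (h.mem n j hj) }

end RadonNikodym

end SCD

theorem mainTheorem12 {𝕜 : Type*} [RCLike 𝕜] {X : Type*} [NormedAddCommGroup X]
    [NormedSpace 𝕜 X] [NormedSpace ℝ X] [IsScalarTower ℝ 𝕜 X] [CompleteSpace X]
    (A : Set X) (hclosed : IsClosed A) (hconv : Convex ℝ A) (hbdd : Bornology.IsBounded A)
    (hsep : TopologicalSpace.IsSeparable A) :
    (SCD.HasSmallCombinationsOfSlices 𝕜 A → SCD.IsSCDSet 𝕜 A) ∧
    (SCD.IsStronglyRegular 𝕜 A → SCD.IsSCDSet 𝕜 A) ∧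
    (SCD.HasCPCP 𝕜 A → SCD.IsSCDSet 𝕜 A) ∧
    (SCD.IsRadonNikodymSet A → SCD.IsSCDSet 𝕜 A) :=
  ⟨fun h => h.isSCDSet hconv hbdd hsep,
    fun h => (h.hasSmallCombinationsOfSlices hconv hbdd).isSCDSet hconv hbdd hsep,
    fun h => (h.hasSmallCombinationsOfSlices hclosed hconv hbdd).isSCDSet hconv hbdd hsep,
    fun h => ((h.isStronglyRegular hclosed hconv hbdd).hasSmallCombinationsOfSlices
      hconv hbdd).isSCDSet hconv hbdd hsep⟩
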